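/- Let $\mathfrak g$ be a finite-dimensional complex simple Lie algebra with Cartan subalgebra $\mathfrak h$, root system $\Delta$, and simple roots $\alpha_1,\dots,\alpha_n$ ($n=\dim\mathfrak h$). Let $\mathfrak b=\mathfrak h\oplus\bigoplus_{\alpha\in\Delta_+}\mathfrak g_\alpha$ be the positive Borel subalgebra, $\mathfrak n=[\mathfrak b,\mathfrak b]$, let $x_0\in\mathfrak h$ be the element with $\alpha_i(x_0)=1$ for all $i$, and let $\mathfrak g_{[-1]}$ be the eigenspace of $\operatorname{ad}x_0$ with eigenvalue $-1$. Call $e\in\mathfrak g$ principal nilpotent if $\operatorname{ad}e$ is nilpotent and the centralizer of $e$ has dimension $n$. Let $l\ge 1$ be an integer, $\mathcal A_l=\mathbb C[t]/(t^{l+1})$, and let $\mathfrak g_l=\mathfrak g\otimes\mathcal A_l$ be the Takiff algebra, with bracket $[x\otimes p,y\otimes q]=[x,y]\otimes pq$. Write $x(j)=x\otimes t^j$, and $S_l=S\otimes\mathcal A_l$ for a subspace $S\subseteq\mathfrak g$. Let $N_l$ be the subgroup of the adjoint group of $\mathfrak g_l$ corresponding to $\mathfrak n_l$, that is, the subgroup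 of $GL(\mathfrak g_l)$ generated by all $\exp(\operatorname{ad}z)$ with $z\in\mathfrak n_l$. For $0\le j\le l$ let $f_j\in\mathfrak g_{[-1]}$ be principal nilpotent, and put $f=\sum_{j=0}^l f_j(j)\in\mathfrak g_l$. Let $\mathfrak s\subseteq\mathfrak b$ be an $\operatorname{ad}x_0$-stable subspace such that $\mathfrak b=[f_0,\mathfrak n]\oplus\mathfrak s$. Then $N_l\subseteq\operatorname{End}(\mathfrak g_l)$ and $f+\mathfrak s_l,\ f+\mathfrak b_l\subseteq\mathfrak g_l$ are Zariski-closed, and with the resulting structures of affine varieties the map $$N_l\times(f+\mathfrak s_l)\longrightarrow f+\mathfrak b_l,\qquad (a,x)\mapsto ax,$$ is an isomorphism of affine varieties: it is a bijective polynomial map whose inverse is also polynomial. -/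

import Mathlib

open scoped TensorProduct Polynomial

/-! ### Affine varieties as Zariski-closed subsets of complex vector spaces -/

section Varieties

variable {V W : Type*} [AddCommGroup V] [Module ℂ V] [AddCommGroup W] [Module ℂ W]

variable (V) in
/-- The algebra of polynomial functions on a complex vector space: the subalgebra of all
functions generated by the linear functionals. -/
def polyFun : Subalgebra ℂ (V → ℂ) :=
  Algebra.adjoin ℂ (Set.range fun (ξ : Module.Dual ℂ V) (v : V) => ξ v)

/-- `X` is the common zero locus of a family of polynomial functions. -/
def IsZariskiClosed (X : Set V) : Prop :=
  ∃ S : Set (V → ℂ), S ⊆ polyFun V ∧ X = {v | ∀ p ∈ S, p v = 0}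

/-- `φ` restricts to a morphism of affine varieties `X → Y`: it maps `X` into `Y`, and every
linear coordinate of `φ` agrees on `X` with a polynomial function of the ambient space. -/
def IsRegularMap (X : Set V) (Y : Set W) (φ : V → W) : Prop :=
  Set.MapsTo φ X Y ∧ ∀ ξ : Module.Dual ℂ W, ∃ p ∈ polyFun V, ∀ v ∈ X, ξ (φ v) = p v

/-- `φ` restricts to an isomorphism of affine varieties `X → Y`: it is a morphism and has a
two-sided inverse morphism `Y → X`. -/
def IsVarietyIso (X : Set V) (Y : Set W) (φ : V → W) : Prop :=
  IsRegularMap X Y φ ∧ ∃ ψ : W → V, IsRegularMap Y X ψ ∧ Set.InvOn ψ φ X Y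

end Varieties

/-! ### Truncated current (Takiff) algebras -/

section Takiff

/-- The truncated polynomial algebra `ℂ[t]/(t^(l+1))`. -/
abbrev TruncPoly (l : ℕ) : Type := ℂ[X] ⧸ Ideal.span {(Polynomial.X : ℂ[X]) ^ (l + 1)}

/-- The class of `t` in `ℂ[t]/(t^(l+1))`. -/
noncomputable def TruncPoly.t (l : ℕ) : TruncPoly l :=
  Ideal.Quotient.mk _ (Polynomial.X : ℂ[X])

variable {𝔤 : Type*} [LieRing 𝔤] [LieAlgebra ℂ 𝔤]

variable (𝔤) in
/-- The Takiff algebra `𝔤_l`, with bracket `[p ⊗ x, q ⊗ y] = pq ⊗ [x, y]`, as a Lie algebra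
over `ℂ`. -/
abbrev Takiff (l : ℕ) : Type _ := TruncPoly l ⊗[ℂ] 𝔤

/-- The element `x(j) = t^j ⊗ x` of `𝔤_l`. -/
noncomputable def Takiff.single (l j : ℕ) (x : 𝔤) : Takiff 𝔤 l := (TruncPoly.t l ^ j) ⊗ₜ[ℂ] x

/-- For a subspace `S` of `𝔤`, the subspace `S_l = ℂ[t]/(t^(l+1)) ⊗ S` of `𝔤_l`. -/
noncomputable def Takiff.sub (l : ℕ) (S : Submodule ℂ 𝔤) : Submodule ℂ (Takiff 𝔤 l) :=
  (S.baseChange (TruncPoly l)).restrictScalars ℂ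

/-- The subgroup of `GL(𝔤_l)` generated by the `exp (ad z)` with `z ∈ 𝔞`. For a subalgebra `𝔞`
acting nilpotently this is the connected Lie subgroup, with Lie algebra `ad 𝔞`, of the adjoint
group of `𝔤_l`. -/
noncomputable def Takiff.expGroup {l : ℕ} (𝔞 : Submodule ℂ (Takiff 𝔤 l)) :
    Subgroup (Module.End ℂ (Takiff 𝔤 l))ˣ :=
  Subgroup.closure {u | ∃ z ∈ 𝔞, IsNilpotent (LieAlgebra.ad ℂ (Takiff 𝔤 l) z) ∧
    (u : Module.End ℂ (Takiff 𝔤 l)) = IsNilpotent.exp (LieAlgebra.ad ℂ (Takiff 𝔤 l) z)}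

/-- `Takiff.expGroup 𝔞` as a subset of the vector space `End(𝔤_l)`. -/
noncomputable def Takiff.expVariety {l : ℕ} (𝔞 : Submodule ℂ (Takiff 𝔤 l)) :
    Set (Module.End ℂ (Takiff 𝔤 l)) :=
  {a | ∃ u ∈ Takiff.expGroup 𝔞, (u : Module.End ℂ (Takiff 𝔤 l)) = a}

/-- The element `∑_j f_j(j)` of `𝔤_l`. -/
noncomputable def Takiff.ofCoeffs {l : ℕ} (f : Fin (l + 1) → 𝔤) : Takiff 𝔤 l :=
  ∑ j : Fin (l + 1), Takiff.single l j (f j)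

/-- The translate `F + 𝔞` of a subspace. -/
def Takiff.translate {l : ℕ} (F : Takiff 𝔤 l) (𝔞 : Submodule ℂ (Takiff 𝔤 l)) :
    Set (Takiff 𝔤 l) :=
  {y | ∃ x ∈ 𝔞, y = F + x}

end Takiff

/-! ### Borel subalgebras, the principal grading and principal nilpotents -/

section Borel

variable {𝔤 : Type*} [LieRing 𝔤] [LieAlgebra ℂ 𝔤] [FiniteDimensional ℂ 𝔤]

/-- `x` is a principal nilpotent element: it is ad-nilpotent and its centralizer has dimension
equal to the rank of `𝔤`, i.e. the dimension of the Cartan subalgebra `H`. -/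
def IsPrincipalNilpotent (H : LieSubalgebra ℂ 𝔤) (x : 𝔤) : Prop :=
  IsNilpotent (LieAlgebra.ad ℂ 𝔤 x) ∧
    Module.finrank ℂ (LinearMap.ker (LieAlgebra.ad ℂ 𝔤 x)) = Module.finrank ℂ H

/-- The subspace `[x, S]` of `𝔤`. -/
noncomputable def lieMap (x : 𝔤) (S : Submodule ℂ 𝔤) : Submodule ℂ 𝔤 :=
  S.map (LieAlgebra.ad ℂ 𝔤 x)

variable [LieAlgebra.IsKilling ℂ 𝔤] {H : LieSubalgebra ℂ 𝔤} [H.IsCartanSubalgebra]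

/-- The positive Borel subalgebra `𝔟`: the sum of `H` and all positive root spaces. -/
noncomputable def borelSub (B : (LieAlgebra.IsKilling.rootSystem H).Base) : Submodule ℂ 𝔤 :=
  H.toSubmodule ⊔
    ⨆ (α : H.root) (_ : B.IsPos α), (LieAlgebra.rootSpace H (α.1 : H → ℂ)).toSubmodule

/-- The nilradical `𝔫 = [𝔟, 𝔟]` of the positive Borel subalgebra. -/
noncomputable def nilrad (B : (LieAlgebra.IsKilling.rootSystem H).Base) : Submodule ℂ 𝔤 :=
  Submodule.span ℂ {z | ∃ x ∈ borelSub B, ∃ y ∈ borelSub B, ⁅x, y⁆ = z}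

/-- The basis of `H` dual to the simple roots. -/
noncomputable def fundCoweight (B : (LieAlgebra.IsKilling.rootSystem H).Base) (i : B.support) :
    H :=
  (Module.evalEquiv ℂ H).symm (B.toWeightBasis.coord i)

/-- The element `x₀ = ∑ ω_i` of `H`. -/
noncomputable def gradingElt (B : (LieAlgebra.IsKilling.rootSystem H).Base) : H :=
  ∑ i : B.support, fundCoweight B i

/-- Every simple root takes the value `1` at `x₀`. -/
theorem root_gradingElt (B : (LieAlgebra.IsKilling.rootSystem H).Base) (i : B.support) :
    (LieAlgebra.IsKilling.rootSystem H).root i (gradingElt B) = 1 := by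
  classical
  simp only [gradingElt, map_sum, fundCoweight, Module.apply_evalEquiv_symm_apply,
    Module.Basis.coord_apply, B.toWeightBasis_repr_root]
  simp [Finsupp.single_apply]

/-- The eigenspace `𝔤_[c]` of `ad x₀` with eigenvalue `c`. -/
noncomputable def gradedPiece (B : (LieAlgebra.IsKilling.rootSystem H).Base) (c : ℤ) :
    Submodule ℂ 𝔤 :=
  Module.End.eigenspace (LieAlgebra.ad ℂ 𝔤 (gradingElt B : 𝔤)) (c : ℂ)

end Borel

/-! Filter `𝔤_l` by the eigenvalues of `ad x₀`: `F 0 = 𝔟_l`, `F 1 = 𝔫_l`, and `f` lies in `F (-1)`.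

The group: `N_l` is exactly the set of bracket-preserving endomorphisms `a` such that `a - 1` raises
the filtration degree by one (`expSubgroup_eq_unipotentAut`). These are polynomial conditions, so
`N_l` is closed. The point is that the leading term of such an `a` is inner and is determined by `a
x₀` (`exists_leading_term`); exponentials peel it off degree by degree.

The slice: since `f₀` is principal, a dimension count shows that `ad f₀` is injective on `𝔫`. Hence
`𝔟 = [f₀, 𝔫] ⊕ 𝔰` yields a linear `P` inverting `ad f₀` on `[f₀, 𝔫]`, killing `𝔰` and raising degree
by one on `𝔟`. It extends to `𝔤_l`, and a geometric series, finite because `t` is nilpotent,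
corrects it from `f₀` to `f` (`IsSliceProjection.exists_add`).

The inverse map: `exp (ad P(y - f))` moves `y` towards `f + 𝔰_l`, each time gaining a degree in the
error. Finitely many steps suffice and each is polynomial (`sliceStep_iterate`). Comparing leading
terms shows that only the identity carries a point of the slice into the slice
(`eq_one_of_map_slice`), so this is a two-sided inverse. -/

/-! ### Polynomial maps -/

section PolynomialMaps

variable {V W W' X : Type*} [AddCommGroup V] [Module ℂ V] [AddCommGroup W] [Module ℂ W]
  [AddCommGroup W'] [Module ℂ W'] [AddCommGroup X] [Module ℂ X]

/-- Every linear coordinate of `φ` is a polynomial function. -/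
def IsPolyMap (φ : V → W) : Prop :=
  ∀ ξ : Module.Dual ℂ W, (fun v => ξ (φ v)) ∈ polyFun V

theorem dual_mem_polyFun (ξ : Module.Dual ℂ V) : (fun v => ξ v) ∈ polyFun V :=
  Algebra.subset_adjoin ⟨ξ, rfl⟩

namespace IsPolyMap

theorem linear (T : V →ₗ[ℂ] W) : IsPolyMap fun v => T v :=
  fun ξ => dual_mem_polyFun (ξ ∘ₗ T)

theorem const (w : W) : IsPolyMap fun _ : V => w :=
  fun ξ => (polyFun V).algebraMap_mem (ξ w)

theorem add {φ ψ : V → W} (hφ : IsPolyMap φ) (hψ : IsPolyMap ψ) :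
    IsPolyMap fun v => φ v + ψ v := fun ξ => by
  have := (polyFun V).add_mem (hφ ξ) (hψ ξ)
  simp only [map_add]
  exact this

theorem linear_comp (T : W →ₗ[ℂ] X) {φ : V → W} (hφ : IsPolyMap φ) :
    IsPolyMap fun v => T (φ v) :=
  fun ξ => hφ (ξ ∘ₗ T)

theorem sub {φ ψ : V → W} (hφ : IsPolyMap φ) (hψ : IsPolyMap ψ) :
    IsPolyMap fun v => φ v - ψ v := by
  simpa [sub_eq_add_neg] using hφ.add (hψ.linear_comp (-LinearMap.id))

theorem sum {ι : Type*} (s : Finset ι) {φ : ι → V → W} (h : ∀ i, IsPolyMap (φ i)) :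
    IsPolyMap fun v => ∑ i ∈ s, φ i v := fun ξ => by
  simp only [map_sum]
  have := (polyFun V).sum_mem (t := s) fun i _ => h i ξ
  convert this using 1
  ext v
  simp

theorem prodMk {φ : V → W} {ψ : V → X} (hφ : IsPolyMap φ) (hψ : IsPolyMap ψ) :
    IsPolyMap fun v => (φ v, ψ v) := by
  simpa using (hφ.linear_comp (LinearMap.inl ℂ W X)).add (hψ.linear_comp (LinearMap.inr ℂ W X))

/-- Expanding the first argument in a finite basis leaves a finite sum of products of two polynomial
functions. -/
theorem bilinear [FiniteDimensional ℂ W] (T : W →ₗ[ℂ] X →ₗ[ℂ] W') {φ : V → W} {ψ : V → X}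
    (hφ : IsPolyMap φ) (hψ : IsPolyMap ψ) : IsPolyMap fun v => T (φ v) (ψ v) := fun ξ => by
  let b := Module.finBasis ℂ W
  have h : (fun v => ξ (T (φ v) (ψ v))) =
      ∑ i, (fun v => b.coord i (φ v)) * fun v => (ξ ∘ₗ T (b i)) (ψ v) := by
    ext v
    conv_lhs => rw [← b.sum_repr (φ v)]
    simp only [map_sum, map_smul, LinearMap.sum_apply, LinearMap.smul_apply, smul_eq_mul,
      Finset.sum_apply, Pi.mul_apply, Module.Basis.coord_apply, LinearMap.comp_apply]
  rw [h]
  exact (polyFun V).sum_mem fun i _ => (polyFun V).mul_mem (hφ _) (hψ _)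

theorem comp {φ : W → X} {ψ : V → W} (hφ : IsPolyMap φ) (hψ : IsPolyMap ψ) :
    IsPolyMap fun v => φ (ψ v) := fun ξ => by
  have h : ∀ p ∈ polyFun W, (fun v => p (ψ v)) ∈ polyFun V := by
    intro p hp
    induction hp using Algebra.adjoin_induction with
    | mem p hp =>
      obtain ⟨η, rfl⟩ := hp
      exact hψ η
    | algebraMap c => exact (polyFun V).algebraMap_mem c
    | add p q _ _ hp hq => exact (polyFun V).add_mem hp hq
    | mul p q _ _ hp hq => exact (polyFun V).mul_mem hp hq
  exact h _ (hφ ξ)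

theorem isRegularMap {φ : V → W} (hφ : IsPolyMap φ) {Y : Set V} {Z : Set W}
    (h : Set.MapsTo φ Y Z) : IsRegularMap Y Z φ :=
  ⟨h, fun ξ => ⟨_, hφ ξ, fun _ _ => rfl⟩⟩

/-- A subspace is cut out by the functionals in its annihilator. -/
theorem isZariskiClosed_preimage {φ : V → W} (hφ : IsPolyMap φ) (S : Submodule ℂ W) :
    IsZariskiClosed {v | φ v ∈ S} := by
  refine ⟨{p | ∃ ξ ∈ S.dualAnnihilator, p = fun v => ξ (φ v)}, ?_, ?_⟩
  · rintro _ ⟨ξ, -, rfl⟩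
    exact hφ ξ
  · ext v
    have h : φ v ∈ S ↔ ∀ ξ ∈ S.dualAnnihilator, ξ (φ v) = 0 := by
      rw [← Submodule.mem_dualCoannihilator, Subspace.dualAnnihilator_dualCoannihilator_eq]
    exact h.trans ⟨fun h p ⟨ξ, hξ, hp⟩ => hp ▸ h ξ hξ, fun h ξ hξ => h _ ⟨ξ, hξ, rfl⟩⟩

end IsPolyMap

theorem IsZariskiClosed.iInter {ι : Sort*} {Y : ι → Set V} (h : ∀ i, IsZariskiClosed (Y i)) :
    IsZariskiClosed (⋂ i, Y i) := by
  choose S hS hY using h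
  refine ⟨⋃ i, S i, Set.iUnion_subset hS, ?_⟩
  ext v
  simp only [Set.mem_iInter, Set.mem_iUnion, Set.mem_ofPred_eq, hY]
  exact ⟨fun h p ⟨i, hi⟩ => h i p hi, fun h i p hi => h p ⟨i, hi⟩⟩

end PolynomialMaps

/-! ### Filtered Lie algebras and their unipotent automorphisms -/

section Filtered

variable {G : Type*} [LieRing G] [LieAlgebra ℂ G]

/-- A finite exhaustive separated decreasing filtration of a Lie algebra. -/
structure IsLieFiltration (F : ℤ → Submodule ℂ G) (M : ℕ) : Prop where
  antitone : Antitone F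
  lie_mem : ∀ {i j : ℤ} {x y : G}, x ∈ F i → y ∈ F j → ⁅x, y⁆ ∈ F (i + j)
  eq_top : F (-M) = ⊤
  eq_bot : F M = ⊥

/-- The endomorphism `D` raises the filtration degree by `k`. -/
def Raises (F : ℤ → Submodule ℂ G) (k : ℤ) (D : Module.End ℂ G) : Prop :=
  ∀ (j : ℤ), ∀ x ∈ F j, D x ∈ F (j + k)

/-- Endomorphisms preserving the bracket and congruent to `1` up to terms raising the filtration
degree by `k`. -/
def unipotentAut (F : ℤ → Submodule ℂ G) (k : ℤ) : Set (Module.End ℂ G) :=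
  {a | (∀ x y, a ⁅x, y⁆ = ⁅a x, a y⁆) ∧ Raises F k (a - 1)}

/-- The exponential series of `ad z`, truncated after `K` terms. -/
noncomputable def truncExp (K : ℕ) (z : G) : Module.End ℂ G :=
  ∑ i ∈ Finset.range K, ((i.factorial : ℂ)⁻¹) • LieAlgebra.ad ℂ G z ^ i

theorem isPolyMap_truncExp [FiniteDimensional ℂ G] (K : ℕ) :
    IsPolyMap (truncExp K : G → Module.End ℂ G) := by
  have h (i : ℕ) : IsPolyMap fun z : G => LieAlgebra.ad ℂ G z ^ i := by
    induction i with
    | zero => simpa using IsPolyMap.const (1 : Module.End ℂ G)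
    | succ i ih =>
      simp only [pow_succ]
      exact ih.bilinear (LinearMap.mul ℂ (Module.End ℂ G))
        (IsPolyMap.linear (LieAlgebra.ad ℂ G : G →ₗ[ℂ] Module.End ℂ G))
  exact IsPolyMap.sum _ fun i => (h i).linear_comp
    (((i.factorial : ℂ)⁻¹) • (LinearMap.id : Module.End ℂ G →ₗ[ℂ] Module.End ℂ G))

variable {F : ℤ → Submodule ℂ G} {M : ℕ}

theorem Raises.mul {k m : ℤ} {D E : Module.End ℂ G} (hD : Raises F k D) (hE : Raises F m E) :
    Raises F (m + k) (D * E) := fun j x hx => by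
  rw [← add_assoc]
  exact hD _ _ (hE j x hx)

theorem Raises.add {k : ℤ} {D E : Module.End ℂ G} (hD : Raises F k D) (hE : Raises F k E) :
    Raises F k (D + E) := fun j x hx => (F _).add_mem (hD j x hx) (hE j x hx)

theorem Raises.smul {k : ℤ} {D : Module.End ℂ G} (c : ℂ) (hD : Raises F k D) :
    Raises F k (c • D) := fun j x hx => (F _).smul_mem c (hD j x hx)

theorem Raises.sum {k : ℤ} {ι : Type*} {s : Finset ι} {D : ι → Module.End ℂ G}
    (hD : ∀ i ∈ s, Raises F k (D i)) : Raises F k (∑ i ∈ s, D i : Module.End ℂ G) := fun j x hx => by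
  rw [LinearMap.sum_apply]
  exact (F _).sum_mem fun i hi => hD i hi j x hx

theorem raises_one : Raises F 0 (1 : Module.End ℂ G) := fun j x hx => by simpa using hx

theorem Raises.pow {k : ℤ} {D : Module.End ℂ G} (hD : Raises F k D) (i : ℕ) :
    Raises F (i * k) (D ^ i) := by
  induction i with
  | zero => simpa using raises_one
  | succ i ih =>
    have := ih.mul hD
    rw [← pow_succ] at this
    convert this using 1
    push_cast
    ring

variable [Module ℚ G] in
/-- The subgroup generated by the `exp (ad z)` with `z ∈ 𝔞` ad-nilpotent. -/
def expSubgroup (𝔞 : Submodule ℂ G) : Subgroup (Module.End ℂ G)ˣ :=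
  Subgroup.closure {u | ∃ z ∈ 𝔞, IsNilpotent (LieAlgebra.ad ℂ G z) ∧
    (u : Module.End ℂ G) = IsNilpotent.exp (LieAlgebra.ad ℂ G z)}

/-! ### Exponentials of `ad z` and the group they generate -/

namespace IsLieFiltration

variable (hF : IsLieFiltration F M)
include hF

theorem raises_mono {k m : ℤ} (h : m ≤ k) {D : Module.End ℂ G} (hD : Raises F k D) :
    Raises F m D := fun j x hx => hF.antitone (by omega) (hD j x hx)

theorem raises_ad {k : ℤ} {z : G} (hz : z ∈ F k) : Raises F k (LieAlgebra.ad ℂ G z) :=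
  fun j x hx => by
    rw [add_comm]
    exact hF.lie_mem hz hx

/-- The whole space is `F (-M)`, and `2 * M` degrees higher the filtration is zero. This bound ends
every induction on degree for endomorphisms. -/
theorem eq_zero_of_raises {k : ℤ} (hk : 2 * M ≤ k) {D : Module.End ℂ G} (hD : Raises F k D) :
    D = 0 := by
  ext x
  have h := hF.antitone (show (M : ℤ) ≤ -M + k by omega) (hD (-M) x (by simp [hF.eq_top]))
  simpa [hF.eq_bot] using h

theorem ad_pow_eq_zero {z : G} (hz : z ∈ F 1) : LieAlgebra.ad ℂ G z ^ (2 * M) = 0 :=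
  hF.eq_zero_of_raises (by push_cast; omega) ((hF.raises_ad hz).pow (2 * M))

theorem isNilpotent_ad {z : G} (hz : z ∈ F 1) : IsNilpotent (LieAlgebra.ad ℂ G z) :=
  ⟨_, hF.ad_pow_eq_zero hz⟩

variable [Module ℚ G]

/-- One cutoff serves all of `F 1`, so the exponential is given there by a single polynomial
formula. -/
theorem truncExp_eq_exp {z : G} (hz : z ∈ F 1) :
    truncExp (2 * M) z = IsNilpotent.exp (LieAlgebra.ad ℂ G z) := by
  rw [IsNilpotent.exp_eq_sum (hF.ad_pow_eq_zero hz), truncExp]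
  refine Finset.sum_congr rfl fun i _ => ?_
  rw [← Rat.cast_smul_eq_qsmul ℂ]
  simp

theorem exp_mul_exp_neg {z : G} (hz : z ∈ F 1) :
    IsNilpotent.exp (LieAlgebra.ad ℂ G z) * IsNilpotent.exp (LieAlgebra.ad ℂ G (-z)) = 1 := by
  rw [map_neg]
  exact IsNilpotent.exp_mul_exp_neg_self (hF.isNilpotent_ad hz)

theorem exp_neg_mul_exp {z : G} (hz : z ∈ F 1) :
    IsNilpotent.exp (LieAlgebra.ad ℂ G (-z)) * IsNilpotent.exp (LieAlgebra.ad ℂ G z) = 1 := by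
  rw [map_neg]
  exact IsNilpotent.exp_neg_mul_exp_self (hF.isNilpotent_ad hz)

theorem exp_lie {z : G} (hz : z ∈ F 1) (x y : G) :
    IsNilpotent.exp (LieAlgebra.ad ℂ G z) ⁅x, y⁆ =
      ⁅IsNilpotent.exp (LieAlgebra.ad ℂ G z) x, IsNilpotent.exp (LieAlgebra.ad ℂ G z) y⁆ :=
  letI := LieRing.toNonUnitalNonAssocRing G
  haveI : SMulCommClass ℂ G G := LieAlgebra.smulCommClass ℂ G
  haveI : IsScalarTower ℂ G G := LieAlgebra.isScalarTower ℂ G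
  Module.End.exp_mul_of_derivation ℂ G (LieAlgebra.ad ℂ G z)
    (fun x y => (leibniz_lie z x y).trans (add_comm _ _)) (hF.isNilpotent_ad hz) x y

/-- The exponential of `ad z` agrees with `1 + ad z` up to terms of twice the degree of `z`. -/
theorem raises_exp_sub {k : ℤ} (hk : 1 ≤ k) {z : G} (hz : z ∈ F k) :
    Raises F (2 * k) (IsNilpotent.exp (LieAlgebra.ad ℂ G z) - 1 - LieAlgebra.ad ℂ G z) := by
  have hz1 : z ∈ F 1 := hF.antitone hk hz
  -- Two surplus terms are allowed in the cutoff so that `1` and `ad z` can be split off whatever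
  -- `M` is.
  rw [IsNilpotent.exp_eq_sum (k := 2 * M + 2) (by rw [pow_add, hF.ad_pow_eq_zero hz1, zero_mul]),
    Finset.sum_range_succ', Finset.sum_range_succ']
  have h : Raises F (2 * k) (∑ i ∈ Finset.range (2 * M),
      (((i + 1 + 1).factorial : ℂ)⁻¹) • LieAlgebra.ad ℂ G z ^ (i + 1 + 1)) := by
    refine Raises.sum fun i _ => Raises.smul _ ?_
    refine hF.raises_mono ?_ ((hF.raises_ad hz).pow (i + 1 + 1))
    push_cast
    nlinarith
  convert h using 1
  simp only [← Rat.cast_smul_eq_qsmul ℂ]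
  simp

theorem exp_mem_unipotentAut {k : ℤ} (hk : 1 ≤ k) {z : G} (hz : z ∈ F k) :
    IsNilpotent.exp (LieAlgebra.ad ℂ G z) ∈ unipotentAut F k := by
  refine ⟨hF.exp_lie (hF.antitone hk hz), ?_⟩
  simpa using (hF.raises_mono (by omega) (hF.raises_exp_sub hk hz)).add (hF.raises_ad hz)

omit [Module ℚ G] in
theorem raises_of_mem {k : ℤ} (hk : 0 ≤ k) {a : Module.End ℂ G} (ha : a ∈ unipotentAut F k) :
    Raises F 0 a := by
  simpa using (hF.raises_mono hk ha.2).add raises_one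

omit [Module ℚ G] in
theorem unipotentAut_mul_mem {k : ℤ} (hk : 0 ≤ k) {a b : Module.End ℂ G} (ha : a ∈ unipotentAut F k)
    (hb : b ∈ unipotentAut F k) : a * b ∈ unipotentAut F k := by
  refine ⟨fun x y => by simp [ha.1, hb.1], ?_⟩
  have h := ((hF.raises_of_mem hk ha).mul hb.2).add (by simpa using ha.2)
  convert h using 1
  · simp
  · noncomm_ring

omit hF [Module ℚ G] in
theorem one_mem_unipotentAut (k : ℤ) : (1 : Module.End ℂ G) ∈ unipotentAut F k :=
  ⟨fun _ _ => rfl, fun _ _ _ => by simp⟩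

theorem unipotentAut_of_mem_expSubgroup {u : (Module.End ℂ G)ˣ} (hu : u ∈ expSubgroup (F 1)) :
    (u : Module.End ℂ G) ∈ unipotentAut F 1 := by
  -- Stability of `unipotentAut` under inverses is not immediate, so the induction carries `u` and
  -- `u⁻¹` together.
  suffices h : (u : Module.End ℂ G) ∈ unipotentAut F 1 ∧
      ((u⁻¹ : (Module.End ℂ G)ˣ) : Module.End ℂ G) ∈ unipotentAut F 1 from h.1
  induction hu using Subgroup.closure_induction with
  | mem u hu =>
    obtain ⟨z, hz, -, h⟩ := hu
    refine ⟨h ▸ hF.exp_mem_unipotentAut le_rfl hz, ?_⟩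
    rw [Units.inv_eq_of_mul_eq_one_right (h ▸ hF.exp_mul_exp_neg hz)]
    exact hF.exp_mem_unipotentAut le_rfl ((F 1).neg_mem hz)
  | one => simpa using one_mem_unipotentAut 1
  | mul u v _ _ hu hv =>
    rw [mul_inv_rev]
    exact ⟨hF.unipotentAut_mul_mem (by norm_num) hu.1 hv.1, hF.unipotentAut_mul_mem (by norm_num) hv.2 hu.2⟩
  | inv u _ hu => simpa using hu.symm

theorem exists_exp_mem_expSubgroup {z : G} (hz : z ∈ F 1) :
    ∃ u ∈ expSubgroup (F 1), (u : Module.End ℂ G) = IsNilpotent.exp (LieAlgebra.ad ℂ G z) :=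
  ⟨⟨_, _, hF.exp_mul_exp_neg hz, hF.exp_neg_mul_exp hz⟩,
    Subgroup.subset_closure ⟨z, hz, hF.isNilpotent_ad hz, rfl⟩, rfl⟩

/-! ### Unipotent automorphisms are products of exponentials -/

section GradingElement

variable {x₀ : G} (hx₀ : x₀ ∈ F 0) (hgr : ∀ (j : ℤ), ∀ x ∈ F j, ⁅x₀, x⁆ - (j : ℂ) • x ∈ F (j + 1))
include hx₀ hgr

omit [Module ℚ G] in
/-- The leading term of a unipotent automorphism is an inner derivation: it can be read off from
the image of the grading element. -/
theorem exists_leading_term {k : ℤ} (hk : 1 ≤ k) {a : Module.End ℂ G}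
    (ha : a ∈ unipotentAut F k) :
    ∃ z ∈ F k, Raises F (k + 1) (a - 1 - LieAlgebra.ad ℂ G z) := by
  have hk0 : (k : ℂ) ≠ 0 := by
    have : k ≠ 0 := by omega
    exact_mod_cast this
  set w := (a - 1) x₀ with hw
  have hwk : w ∈ F k := by simpa only [zero_add] using ha.2 0 x₀ hx₀
  -- Modulo `F (j + k + 1)`, the identity `a ⁅x₀, x⁆ = ⁅a x₀, a x⁆` reads `j (a - 1) x = ⁅w, x⁆ + (j
  -- + k) (a - 1) x`, so `(a - 1) x = -k⁻¹ ⁅w, x⁆`.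
  refine ⟨-(k : ℂ)⁻¹ • w, (F k).smul_mem _ hwk, fun j x hx => ?_⟩
  have hax : (a - 1) x ∈ F (j + k) := ha.2 j x hx
  have h1 : (a - 1) (⁅x₀, x⁆ - (j : ℂ) • x) ∈ F (j + (k + 1)) := by
    convert ha.2 _ _ (hgr j x hx) using 2
    ring
  have h2 : ⁅x₀, (a - 1) x⁆ - ((j + k : ℤ) : ℂ) • (a - 1) x ∈ F (j + (k + 1)) := by
    convert hgr _ _ hax using 2
    ring
  have h3 : ⁅w, (a - 1) x⁆ ∈ F (j + (k + 1)) :=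
    hF.antitone (by omega) (hF.lie_mem hwk hax)
  have h4 : (a - 1) ⁅x₀, x⁆ = ⁅w, x⁆ + ⁅x₀, (a - 1) x⁆ + ⁅w, (a - 1) x⁆ := by
    simp only [hw, LinearMap.sub_apply, Module.End.one_apply, ha.1, lie_sub, sub_lie]
    abel
  have h5 : (a - 1 - LieAlgebra.ad ℂ G (-(k : ℂ)⁻¹ • w)) x = (k : ℂ)⁻¹ •
      ((a - 1) (⁅x₀, x⁆ - (j : ℂ) • x) - (⁅x₀, (a - 1) x⁆ - ((j + k : ℤ) : ℂ) • (a - 1) x)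
        - ⁅w, (a - 1) x⁆) := by
    rw [map_sub, h4, map_smul (a - 1), LinearMap.sub_apply (a - 1), LieAlgebra.ad_apply, smul_lie]
    push_cast
    rw [add_smul]
    have : (a - 1) x = (k : ℂ)⁻¹ • (k : ℂ) • (a - 1) x := by rw [inv_smul_smul₀ hk0]
    conv_lhs => rw [this]
    rw [neg_smul, sub_neg_eq_add, ← smul_add]
    congr 1
    abel
  rw [h5]
  exact (F _).smul_mem _ ((F _).sub_mem ((F _).sub_mem h1 h2) h3)

/-- Multiplying by `exp (ad (-z))`, with `ad z` the leading term of `a`, gains one degree; `n`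
bounds the degrees still to be gained before `a` must be `1`. -/
theorem mem_expSubgroup_of_unipotentAut (n : ℕ) : ∀ (k : ℤ), 1 ≤ k → 2 * (M : ℤ) ≤ k + n →
    ∀ a ∈ unipotentAut F k, ∃ u ∈ expSubgroup (F 1), (u : Module.End ℂ G) = a := by
  induction n with
  | zero =>
    intro k hk hM a ha
    refine ⟨1, one_mem _, ?_⟩
    have := hF.eq_zero_of_raises (by simpa using hM) ha.2
    simpa using (sub_eq_zero.mp this).symm
  | succ n ih =>
    intro k hk hM a ha
    obtain ⟨z, hz, hr⟩ := hF.exists_leading_term hx₀ hgr hk ha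
    have hz' : -z ∈ F k := (F k).neg_mem hz
    obtain ⟨u, hu, hu'⟩ := hF.exists_exp_mem_expSubgroup (hF.antitone hk hz)
    obtain ⟨v, hv, hv'⟩ := ih (k + 1) (by omega) (by push_cast at hM; omega)
      (IsNilpotent.exp (LieAlgebra.ad ℂ G (-z)) * a) ⟨fun x y => by
        rw [Module.End.mul_apply, ha.1, hF.exp_lie (hF.antitone hk hz')]; rfl, by
        -- With `E = exp (ad (-z))`, one has `E a - 1 = (E - 1 + ad z) a - ad z (a - 1) + (a - 1 -
        -- ad z)`, of degrees `2k`, `2k` and `k + 1`.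
        have e1 := (hF.raises_exp_sub hk hz').mul (hF.raises_of_mem (by omega) ha)
        have e2 := ((hF.raises_ad hz').mul ha.2)
        have := ((hF.raises_mono (m := k + 1) (by omega) e1).add
          (hF.raises_mono (m := k + 1) (by omega) e2)).add hr
        convert this using 1
        rw [map_neg]
        noncomm_ring⟩
    refine ⟨u * v, mul_mem hu hv, ?_⟩
    rw [Units.val_mul, hu', hv', ← mul_assoc, hF.exp_mul_exp_neg (hF.antitone hk hz), one_mul]

theorem expSubgroup_eq_unipotentAut :
    {a | ∃ u ∈ expSubgroup (F 1), (u : Module.End ℂ G) = a} = unipotentAut F 1 := by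
  ext a
  constructor
  · rintro ⟨u, hu, rfl⟩
    exact hF.unipotentAut_of_mem_expSubgroup hu
  · exact hF.mem_expSubgroup_of_unipotentAut hx₀ hgr (2 * M) 1 le_rfl (by push_cast; omega) a

end GradingElement

end IsLieFiltration

/-- For fixed vectors, preserving the bracket is a quadratic condition on `a`, and raising the
degree is an affine linear one. -/
theorem isZariskiClosed_unipotentAut [FiniteDimensional ℂ G] (F : ℤ → Submodule ℂ G) (k : ℤ) :
    IsZariskiClosed (unipotentAut F k) := by
  let ev (x : G) : Module.End ℂ G →ₗ[ℂ] G := LinearMap.applyₗ x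
  have h : unipotentAut F k = (⋂ (x : G) (y : G), {a | ev ⁅x, y⁆ a -
      (LieModule.toEnd ℂ G G : G →ₗ[ℂ] Module.End ℂ G) (ev x a) (ev y a) ∈ (⊥ : Submodule ℂ G)})
      ∩ ⋂ (j : ℤ) (x : G) (_ : x ∈ F j), {a | ev x a - x ∈ F (j + k)} := by
    ext a
    simp [unipotentAut, Raises, ev, sub_eq_zero]
  rw [h, Set.inter_eq_iInter]
  refine IsZariskiClosed.iInter fun b => ?_
  cases b
  · exact IsZariskiClosed.iInter fun j => IsZariskiClosed.iInter fun x => IsZariskiClosed.iInter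
      fun _ => ((IsPolyMap.linear (ev x)).sub (IsPolyMap.const x)).isZariskiClosed_preimage _
  · exact IsZariskiClosed.iInter fun x => IsZariskiClosed.iInter fun y =>
      ((IsPolyMap.linear (ev ⁅x, y⁆)).sub (IsPolyMap.bilinear _ (IsPolyMap.linear (ev x))
        (IsPolyMap.linear (ev y)))).isZariskiClosed_preimage _

/-! ### Slices for the action of the unipotent group -/

/-- A linear map `P` computing, for `x` in `F 0`, the component in `F 1` of `x` with respect to a
decomposition `F 0 = [f, F 1] ⊕ s` compatible with the filtration. -/
structure IsSliceProjection (F : ℤ → Submodule ℂ G) (f : G) (s : Submodule ℂ G)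
    (P : G →ₗ[ℂ] G) : Prop where
  map_mem : ∀ {k : ℤ}, 0 ≤ k → ∀ {x}, x ∈ F k → P x ∈ F (k + 1)
  sub_mem : ∀ {x}, x ∈ F 0 → x - ⁅f, P x⁆ ∈ s
  map_slice : ∀ {x}, x ∈ s → P x = 0
  map_lie : ∀ {z}, z ∈ F 1 → P ⁅f, z⁆ = z

/-- One step moves `w` towards the slice by `exp (ad P(w - f))`, and records the inverse of the
product of the group elements used. -/
noncomputable def sliceStep (K : ℕ) (f : G) (P : G →ₗ[ℂ] G) (q : Module.End ℂ G × G) :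
    Module.End ℂ G × G :=
  (q.1 * truncExp K (-P (q.2 - f)), truncExp K (P (q.2 - f)) q.2)

/-- Truncated exponentials are polynomial on all of `G`, so no condition on `y` is needed. -/
theorem isPolyMap_sliceStep_iterate [FiniteDimensional ℂ G] (K : ℕ) (f : G) (P : G →ₗ[ℂ] G)
    (n : ℕ) : IsPolyMap fun y : G => (sliceStep K f P)^[n] (1, y) := by
  induction n with
  | zero => exact (IsPolyMap.const _).prodMk (IsPolyMap.linear LinearMap.id)
  | succ n ih =>
    simp only [Function.iterate_succ', Function.comp_apply]
    have h1 := ih.linear_comp (LinearMap.fst ℂ (Module.End ℂ G) G)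
    have h2 := ih.linear_comp (LinearMap.snd ℂ (Module.End ℂ G) G)
    have h3 := (h2.sub (IsPolyMap.const f)).linear_comp P
    exact (h1.bilinear (LinearMap.mul ℂ (Module.End ℂ G)) ((isPolyMap_truncExp K).comp
      (h3.linear_comp (-LinearMap.id)))).prodMk
      (((isPolyMap_truncExp K).comp h3).bilinear LinearMap.id h2)

/-! ### Termination of the slice iteration and freeness of the action -/

namespace IsLieFiltration

variable [Module ℚ G] (hF : IsLieFiltration F M) {f : G} {s : Submodule ℂ G} {P : G →ₗ[ℂ] G}
  (hf : f ∈ F (-1)) (hP : IsSliceProjection F f s P)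
include hF hf hP

/-- Put `w = q.2 - f` and `z = P w`. Then `exp (ad z)` sends `f + w` to `f + (w - ⁅f, z⁆) + r`. The
bracketed part lies in `s`, where `P` vanishes, so the next correction is `P r`, one degree deeper
than `z`. -/
theorem sliceStep_iterate (n : ℕ) {y : G} (hy : y - f ∈ F 0) :
    let q := (sliceStep (2 * M) f P)^[n] (1, y)
    q.1 ∈ unipotentAut F 1 ∧ q.1 q.2 = y ∧ q.2 - f ∈ F 0 ∧ P (q.2 - f) ∈ F (n + 1) := by
  induction n with
  | zero => exact ⟨one_mem_unipotentAut 1, rfl, hy, by simpa using hP.map_mem le_rfl hy⟩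
  | succ n ih =>
    simp only [Function.iterate_succ', Function.comp_apply]
    obtain ⟨h1, h2, h3, h4⟩ := ih
    set q := (sliceStep (2 * M) f P)^[n] (1, y)
    set z := P (q.2 - f) with hz
    have hz1 : z ∈ F 1 := hF.antitone (by omega) h4
    have hz1' : -z ∈ F 1 := (F 1).neg_mem hz1
    have hw : q.2 ∈ F (-1) := by
      have := (F (-1)).add_mem (hF.antitone (by norm_num) h3) hf
      simpa using this
    simp only [sliceStep, ← hz, hF.truncExp_eq_exp hz1, hF.truncExp_eq_exp hz1']
    set e := IsNilpotent.exp (LieAlgebra.ad ℂ G z) with he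
    set r := ⁅z, q.2 - f⁆ + (e - 1 - LieAlgebra.ad ℂ G z) q.2 with hr
    have hrF : r ∈ F (n + 1) := by
      refine (F _).add_mem (by simpa using hF.lie_mem h4 h3) ?_
      -- The higher-order terms gain `2 (n + 1)` degrees, and `q.2` is only in `F (-1)`; `2n + 1 ≥ n
      -- + 1` still suffices.
      exact hF.antitone (by omega) (hF.raises_exp_sub (by omega) h4 _ _ hw)
    have hr' : e q.2 - f = (q.2 - f - ⁅f, z⁆) + r := by
      simp only [hr, LinearMap.sub_apply, Module.End.one_apply, LieAlgebra.ad_apply, lie_sub]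
      rw [← lie_skew f z]
      abel
    refine ⟨hF.unipotentAut_mul_mem zero_le_one h1 (hF.exp_mem_unipotentAut le_rfl hz1'), ?_, ?_,
      ?_⟩
    · rw [Module.End.mul_apply, ← Module.End.mul_apply _ e, hF.exp_neg_mul_exp hz1,
        Module.End.one_apply, h2]
    · rw [hr']
      refine (F 0).add_mem ((F 0).sub_mem h3 ?_) (hF.antitone (by omega) hrF)
      simpa using hF.lie_mem hf hz1
    · rw [hr', map_add, hP.map_slice (hP.sub_mem h3), zero_add]
      push_cast
      exact hP.map_mem (by omega) hrF

omit [Module ℚ G] in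
-- If `ad z` is the leading term of `a`, then `x' - x = -⁅f, z⁆ + r` with `r` of the degree of `z`.
-- Applying `P` gives `z = P r`, one degree deeper, so `a - 1` raises degree by arbitrarily much.
theorem eq_one_of_map_slice {x₀ : G} (hx₀ : x₀ ∈ F 0)
    (hgr : ∀ (j : ℤ), ∀ x ∈ F j, ⁅x₀, x⁆ - (j : ℂ) • x ∈ F (j + 1)) (hs : s ≤ F 0)
    {a : Module.End ℂ G} (ha : a ∈ unipotentAut F 1) {x x' : G} (hx : x ∈ s) (hx' : x' ∈ s)
    (h : a (f + x) = f + x') : a = 1 := by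
  have key : ∀ n : ℕ, a ∈ unipotentAut F (n + 1) := by
    intro n
    induction n with
    | zero => simpa using ha
    | succ n ih =>
      refine ⟨ha.1, ?_⟩
      obtain ⟨z, hz, hr⟩ := hF.exists_leading_term hx₀ hgr (by omega) ih
      set r := (a - 1 - LieAlgebra.ad ℂ G z) f + (a - 1) x with hrdef
      have hrF : r ∈ F (n + 1) := by
        refine (F _).add_mem ?_ ?_
        · convert hr _ _ hf using 2
          ring
        · simpa using ih.2 _ _ (hs hx)
      have hxx : x' - x = -⁅f, z⁆ + r := by
        have : x' = a (f + x) - f := by rw [h]; abel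
        rw [this, hrdef]
        simp only [map_add, LinearMap.sub_apply, Module.End.one_apply, LieAlgebra.ad_apply]
        rw [← lie_skew f z]
        abel
      have hPz : z = P r := by
        have := congrArg P hxx
        rw [map_sub, hP.map_slice hx, hP.map_slice hx', map_add, map_neg,
          hP.map_lie (hF.antitone (by omega) hz)] at this
        rw [sub_zero] at this
        exact (neg_add_eq_zero.mp this.symm)
      have hz' : z ∈ F (n + 1 + 1) := hPz ▸ hP.map_mem (by omega) hrF
      push_cast
      simpa using hr.add (hF.raises_ad hz')
  exact sub_eq_zero.mp (hF.eq_zero_of_raises (by push_cast; omega) (key (2 * M)).2)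

/-- The unipotent group acts freely on `f + F 0`, with slice `f + s`. -/
theorem isVarietyIso_action [FiniteDimensional ℂ G] {x₀ : G} (hx₀ : x₀ ∈ F 0)
    (hgr : ∀ (j : ℤ), ∀ x ∈ F j, ⁅x₀, x⁆ - (j : ℂ) • x ∈ F (j + 1)) (hs : s ≤ F 0) :
    IsVarietyIso (unipotentAut F 1 ×ˢ {y | ∃ x ∈ s, y = f + x}) {y | ∃ x ∈ F 0, y = f + x}
      (fun p => p.1 p.2) := by
  have hmaps : Set.MapsTo (fun p : Module.End ℂ G × G => p.1 p.2)
      (unipotentAut F 1 ×ˢ {y | ∃ x ∈ s, y = f + x}) {y | ∃ x ∈ F 0, y = f + x} := by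
    rintro ⟨a, _⟩ ⟨ha, x, hx, rfl⟩
    refine ⟨(a - 1) f + a x, (F 0).add_mem ?_ ?_, ?_⟩
    · simpa using ha.2 _ _ hf
    · simpa using hF.raises_of_mem zero_le_one ha _ _ (hs hx)
    · simp only [map_add, LinearMap.sub_apply, Module.End.one_apply]
      abel
  have hψ : Set.MapsTo (fun y : G => (sliceStep (2 * M) f P)^[M] (1, y))
      {y | ∃ x ∈ F 0, y = f + x} (unipotentAut F 1 ×ˢ {y | ∃ x ∈ s, y = f + x}) := by
    rintro _ ⟨x, hx, rfl⟩
    obtain ⟨h1, -, h3, h4⟩ := hF.sliceStep_iterate hf hP M (y := f + x) (by simpa using hx)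
    refine ⟨h1, _, ?_, (add_sub_cancel f _).symm⟩
    -- After `M` steps the correction lies in `F (M + 1) = 0`, which means that the slice has been
    -- reached.
    have h0 := hF.antitone (show (M : ℤ) ≤ M + 1 by omega) h4
    rw [hF.eq_bot, Submodule.mem_bot] at h0
    have := hP.sub_mem h3
    rwa [h0, lie_zero, sub_zero] at this
  have hright : ∀ y ∈ {y | ∃ x ∈ F 0, y = f + x},
      ((sliceStep (2 * M) f P)^[M] (1, y)).1 ((sliceStep (2 * M) f P)^[M] (1, y)).2 = y := by
    rintro _ ⟨x, hx, rfl⟩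
    exact (hF.sliceStep_iterate hf hP M (y := f + x) (by simpa using hx)).2.1
  refine ⟨IsPolyMap.isRegularMap (IsPolyMap.bilinear (W := Module.End ℂ G) LinearMap.id
    (IsPolyMap.linear (LinearMap.fst ℂ (Module.End ℂ G) G))
    (IsPolyMap.linear (LinearMap.snd ℂ (Module.End ℂ G) G))) hmaps, _,
    (isPolyMap_sliceStep_iterate (2 * M) f P M).isRegularMap hψ, ?_, hright⟩
  rintro ⟨a, y⟩ hay
  have hy := hmaps hay
  have hb := hψ hy
  have hab := hright _ hy
  simp only at hy hb hab ⊢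
  obtain ⟨ha, x, hx, rfl⟩ := hay
  set q := (sliceStep (2 * M) f P)^[M] (1, a (f + x))
  obtain ⟨hb, x', hx', hq⟩ := hb
  -- Both endomorphisms are lifted to units so that `v⁻¹ * u`, which carries `f + x` to `f + x'`,
  -- can be formed.
  obtain ⟨u, hu, hua⟩ : a ∈ {a | ∃ u ∈ expSubgroup (F 1), (u : Module.End ℂ G) = a} := by
    rwa [hF.expSubgroup_eq_unipotentAut hx₀ hgr]
  obtain ⟨v, hv, hvb⟩ : q.1 ∈ {a | ∃ u ∈ expSubgroup (F 1), (u : Module.End ℂ G) = a} := by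
    rwa [hF.expSubgroup_eq_unipotentAut hx₀ hgr]
  have hvu : ((v⁻¹ * u : (Module.End ℂ G)ˣ) : Module.End ℂ G) (f + x) = f + x' := by
    rw [Units.val_mul, Module.End.mul_apply, hua]
    rw [← hab, ← hvb, ← Module.End.mul_apply, Units.inv_mul, Module.End.one_apply, hq]
  have h1 := hF.eq_one_of_map_slice hf hP hx₀ hgr hs
    (hF.unipotentAut_of_mem_expSubgroup (mul_mem (inv_mem hv) hu)) hx hx' hvu
  have huv : u = v := (inv_mul_eq_one.mp (Units.ext h1)).symm
  refine Prod.ext ?_ ?_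
  · rw [← hvb, ← huv]
    exact hua
  · rw [h1] at hvu
    exact hq.trans hvu.symm

end IsLieFiltration

end Filtered

/-! ### The principal grading -/

section PrincipalGrading

/-- The modular law: meeting `s i ⊔ ⨆ j ≠ i, t j = ⊤` with `t i` leaves `s i`. -/
theorem iSupIndep.eq_of_le_of_iSup_eq_top {α ι : Type*} [CompleteLattice α] [IsModularLattice α]
    {s t : ι → α} (ht : iSupIndep t) (hst : ∀ i, s i ≤ t i) (hs : ⨆ i, s i = ⊤) (i : ι) :
    s i = t i := by
  refine le_antisymm (hst i) ?_
  have h1 : s i ⊔ ⨆ (j) (_ : j ≠ i), t j = ⊤ := by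
    rw [eq_top_iff, ← hs]
    refine iSup_le fun j => ?_
    by_cases hj : j = i
    · subst hj
      exact le_sup_left
    · exact (hst j).trans ((le_iSup₂ (f := fun j _ => t j) j hj).trans le_sup_right)
  have h2 := sup_inf_assoc_of_le (⨆ (j) (_ : j ≠ i), t j) (hst i)
  rw [h1, top_inf_eq, inf_comm, (ht i).eq_bot, sup_bot_eq] at h2
  exact h2.le

variable {𝔤 : Type*} [LieRing 𝔤] [LieAlgebra ℂ 𝔤] [FiniteDimensional ℂ 𝔤]
  [LieAlgebra.IsKilling ℂ 𝔤] {H : LieSubalgebra ℂ 𝔤} [H.IsCartanSubalgebra]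
  (B : (LieAlgebra.IsKilling.rootSystem H).Base)

variable {B} in
theorem mem_gradedPiece {j : ℤ} {x : 𝔤} :
    x ∈ gradedPiece B j ↔ ⁅(gradingElt B : 𝔤), x⁆ = (j : ℂ) • x :=
  Module.End.mem_eigenspace_iff

theorem root_gradingElt_eq_height (α : H.root) : α.1 (gradingElt B) = (B.height α : ℂ) := by
  obtain ⟨c, -, -, hc⟩ := B.exists_root_eq_sum_int α
  rw [RootPairing.Base.height_eq_sum hc]
  have h := congrArg (fun ξ => ξ (gradingElt B)) hc
  rw [LieAlgebra.IsKilling.rootSystem_root_apply] at h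
  refine h.trans ?_
  rw [LinearMap.sum_apply]
  push_cast
  refine Finset.sum_congr rfl fun i hi => ?_
  rw [LinearMap.smul_apply, root_gradingElt B ⟨i, hi⟩]
  simp

variable {B} in
theorem lie_mem_gradedPiece {i j : ℤ} {x y : 𝔤} (hx : x ∈ gradedPiece B i)
    (hy : y ∈ gradedPiece B j) : ⁅x, y⁆ ∈ gradedPiece B (i + j) := by
  rw [mem_gradedPiece] at *
  rw [leibniz_lie, hx, hy, smul_lie, lie_smul]
  push_cast
  rw [add_smul]

theorem rootSpace_le_gradedPiece (α : H.root) :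
    (LieAlgebra.rootSpace H (α.1 : H → ℂ)).toSubmodule ≤ gradedPiece B (B.height α) := by
  intro x hx
  rw [mem_gradedPiece, ← root_gradingElt_eq_height]
  exact LieAlgebra.IsKilling.lie_eq_smul_of_mem_rootSpace hx (gradingElt B)

theorem cartan_le_gradedPiece : H.toSubmodule ≤ gradedPiece B 0 := by
  intro x hx
  rw [mem_gradedPiece]
  have h := LieModule.IsTrivial.trivial (gradingElt B) (⟨x, hx⟩ : H)
  simpa using congrArg (Subtype.val) h

theorem iSupIndep_gradedPiece : iSupIndep (gradedPiece B) :=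
  (Module.End.eigenspaces_iSupIndep (LieAlgebra.ad ℂ 𝔤 (gradingElt B : 𝔤))).comp
    (f := fun j : ℤ => (j : ℂ)) Int.cast_injective

/-- The graded pieces are sums of weight spaces. -/
theorem gradedPiece_eq (j : ℤ) : gradedPiece B j = (⨆ _ : j = 0, H.toSubmodule) ⊔
    ⨆ (α : H.root) (_ : B.height α = j), (LieAlgebra.rootSpace H (α.1 : H → ℂ)).toSubmodule := by
  refine ((iSupIndep_gradedPiece B).eq_of_le_of_iSup_eq_top (s := fun j =>
    (⨆ _ : j = 0, H.toSubmodule) ⊔ ⨆ (α : H.root) (_ : B.height α = j),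
      (LieAlgebra.rootSpace H (α.1 : H → ℂ)).toSubmodule) (fun j => ?_) ?_ j).symm
  · refine sup_le (iSup_le ?_) (iSup₂_le ?_)
    · rintro rfl
      exact cartan_le_gradedPiece B
    · rintro α rfl
      exact rootSpace_le_gradedPiece B α
  · have h := congrArg LieSubmodule.toSubmodule (LieModule.iSup_genWeightSpace_eq_top' ℂ H 𝔤)
    rw [LieSubmodule.iSup_toSubmodule, LieSubmodule.top_toSubmodule] at h
    rw [eq_top_iff, ← h]
    refine iSup_le fun χ => ?_
    by_cases hχ : χ.IsZero
    · have : LieModule.genWeightSpace 𝔤 (χ : H → ℂ) = LieAlgebra.rootSpace H 0 := by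
        rw [hχ.eq]
      rw [this, LieAlgebra.rootSpace_zero_eq]
      refine le_trans ?_ (le_iSup _ 0)
      exact le_sup_of_le_left (le_iSup_of_le rfl le_rfl)
    · have hmem : χ ∈ H.root := by simpa [LieSubalgebra.root] using hχ
      refine le_trans ?_ (le_iSup _ (B.height ⟨χ, hmem⟩))
      exact le_sup_of_le_right (le_iSup₂_of_le ⟨χ, hmem⟩ rfl le_rfl)

theorem iSup_gradedPiece : ⨆ j, gradedPiece B j = ⊤ := by
  have h := congrArg LieSubmodule.toSubmodule (LieModule.iSup_genWeightSpace_eq_top' ℂ H 𝔤)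
  rw [LieSubmodule.iSup_toSubmodule, LieSubmodule.top_toSubmodule] at h
  rw [eq_top_iff, ← h]
  refine iSup_le fun χ => ?_
  by_cases hχ : χ.IsZero
  · have : LieModule.genWeightSpace 𝔤 (χ : H → ℂ) = LieAlgebra.rootSpace H 0 := by
      rw [hχ.eq]
    rw [this, LieAlgebra.rootSpace_zero_eq]
    exact (cartan_le_gradedPiece B).trans (le_iSup _ 0)
  · have hmem : χ ∈ H.root := by simpa [LieSubalgebra.root] using hχ
    exact (rootSpace_le_gradedPiece B ⟨χ, hmem⟩).trans (le_iSup _ _)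

theorem gradedPiece_zero : gradedPiece B 0 = H.toSubmodule := by
  rw [gradedPiece_eq]
  simp [B.height_ne_zero]

/-! ### The principal filtration, the Borel subalgebra and its nilradical -/

/-- The decreasing filtration associated with the principal grading. -/
noncomputable def gradedFiltration (k : ℤ) : Submodule ℂ 𝔤 :=
  ⨆ (j : ℤ) (_ : k ≤ j), gradedPiece B j

variable {B}

theorem gradedPiece_le_gradedFiltration {j k : ℤ} (h : k ≤ j) :
    gradedPiece B j ≤ gradedFiltration B k :=
  le_iSup₂_of_le j h le_rfl

theorem map_gradedFiltration_le {k : ℤ} {S : Submodule ℂ 𝔤} (T : 𝔤 →ₗ[ℂ] 𝔤)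
    (h : ∀ (j : ℤ), k ≤ j → ∀ x ∈ gradedPiece B j, T x ∈ S) {x : 𝔤}
    (hx : x ∈ gradedFiltration B k) : T x ∈ S := by
  have : gradedFiltration B k ≤ S.comap T := iSup₂_le h
  exact this hx

theorem exists_forall_gradedPiece_eq_bot (B : (LieAlgebra.IsKilling.rootSystem H).Base) :
    ∃ M : ℕ, ∀ j : ℤ, gradedPiece B j ≠ ⊥ → -(M : ℤ) ≤ j ∧ j < M := by
  have hfin := WellFoundedGT.finite_ne_bot_of_iSupIndep (iSupIndep_gradedPiece B)
  obtain ⟨M, hM⟩ := (hfin.image fun j => j.natAbs).bddAbove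
  -- The extra `1` makes the upper bound strict, so that the filtration vanishes at this index.
  refine ⟨M + 1, fun j hj => ?_⟩
  have := hM ⟨j, hj, rfl⟩
  simp only at this
  omega

theorem exists_isLieFiltration_gradedFiltration (B : (LieAlgebra.IsKilling.rootSystem H).Base) :
    ∃ M, IsLieFiltration (gradedFiltration B) M := by
  obtain ⟨M, hM⟩ := exists_forall_gradedPiece_eq_bot B
  refine ⟨M, ⟨fun k m h => iSup₂_le fun j hj => gradedPiece_le_gradedFiltration (h.trans hj),
    fun {i j x y} hx hy => ?_, ?_, ?_⟩⟩
  · refine map_gradedFiltration_le (LieAlgebra.ad ℂ 𝔤 x) (fun j' hj' y hy => ?_) hy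
    rw [LieAlgebra.ad_apply, ← lie_skew, ← LieAlgebra.ad_apply ℂ, ← LinearMap.neg_apply]
    refine map_gradedFiltration_le _ (fun i' hi' x hx => ?_) hx
    rw [LinearMap.neg_apply, LieAlgebra.ad_apply, lie_skew]
    exact gradedPiece_le_gradedFiltration (by omega) (lie_mem_gradedPiece hx hy)
  · rw [eq_top_iff, ← iSup_gradedPiece B]
    refine iSup_le fun j => ?_
    by_cases hj : gradedPiece B j = ⊥
    · simp [hj]
    · exact gradedPiece_le_gradedFiltration (hM j hj).1
  · refine eq_bot_iff.mpr (iSup₂_le fun j hj => ?_)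
    by_contra hne
    exact absurd (hM j fun h => hne h.le).2 (not_lt.mpr hj)

theorem gradingElt_mem : (gradingElt B : 𝔤) ∈ gradedFiltration B 0 :=
  gradedPiece_le_gradedFiltration le_rfl (cartan_le_gradedPiece B (gradingElt B).2)

/-- On degree `i ≥ j` the operator `ad x₀ - j` is the scalar `i - j`, which kills the bottom degree.
-/
theorem lie_gradingElt_sub_mem (j : ℤ) {x : 𝔤} (hx : x ∈ gradedFiltration B j) :
    ⁅(gradingElt B : 𝔤), x⁆ - (j : ℂ) • x ∈ gradedFiltration B (j + 1) := by
  refine map_gradedFiltration_le (LieAlgebra.ad ℂ 𝔤 (gradingElt B : 𝔤) - (j : ℂ) • LinearMap.id)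
    (fun i hi y hy => ?_) hx
  have h : (LieAlgebra.ad ℂ 𝔤 (gradingElt B : 𝔤) - (j : ℂ) • (LinearMap.id : 𝔤 →ₗ[ℂ] 𝔤)) y =
      ((i : ℂ) - j) • y := by
    simp [mem_gradedPiece.mp hy, sub_smul]
  rw [h]
  rcases hi.eq_or_lt with rfl | hlt
  · simp
  · exact Submodule.smul_mem _ _ (gradedPiece_le_gradedFiltration (by omega) hy)

theorem borelSub_eq : borelSub B = gradedFiltration B 0 := by
  refine le_antisymm (sup_le ?_ (iSup₂_le fun α hα => ?_)) (iSup₂_le fun j hj => ?_)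
  · exact (cartan_le_gradedPiece B).trans (gradedPiece_le_gradedFiltration le_rfl)
  · exact (rootSpace_le_gradedPiece B α).trans
      (gradedPiece_le_gradedFiltration (B.isPos_iff'.mp hα))
  · rw [gradedPiece_eq]
    refine sup_le (iSup_le fun _ => le_sup_left) (iSup₂_le fun α hα => ?_)
    exact le_sup_of_le_right
      (le_iSup₂_of_le α (B.isPos_iff'.mpr (hα ▸ hj)) le_rfl)

/-- Degree zero is the abelian `H`, so brackets within `𝔟` have positive degree. Conversely `ad x₀`
is invertible on each positive degree. -/
theorem nilrad_eq : nilrad B = gradedFiltration B 1 := by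
  obtain ⟨M, hF⟩ := exists_isLieFiltration_gradedFiltration B
  have hb : ∀ x ∈ borelSub B, ∀ y ∈ borelSub B, ⁅x, y⁆ ∈ gradedFiltration B 1 := by
    intro x hx y hy
    rw [borelSub_eq] at hx hy
    refine map_gradedFiltration_le (LieAlgebra.ad ℂ 𝔤 x) (fun j hj y hy => ?_) hy
    rw [LieAlgebra.ad_apply, ← lie_skew, ← LieAlgebra.ad_apply ℂ, ← LinearMap.neg_apply]
    refine map_gradedFiltration_le _ (fun i hi x hx => ?_) hx
    rw [LinearMap.neg_apply, LieAlgebra.ad_apply, lie_skew]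
    by_cases h : 1 ≤ i + j
    · exact gradedPiece_le_gradedFiltration h (lie_mem_gradedPiece hx hy)
    · obtain rfl : i = 0 := by omega
      obtain rfl : j = 0 := by omega
      rw [gradedPiece_zero] at hx hy
      have h := LieModule.IsTrivial.trivial (⟨x, hx⟩ : H) (⟨y, hy⟩ : H)
      have h' : ⁅x, y⁆ = 0 := by simpa using congrArg (Subtype.val) h
      rw [h']
      exact Submodule.zero_mem _
  refine le_antisymm (Submodule.span_le.mpr ?_) (iSup₂_le fun j hj x hx => ?_)
  · rintro _ ⟨x, hx, y, hy, rfl⟩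
    exact hb x hx y hy
  · have hj0 : (j : ℂ) ≠ 0 := by
      have : j ≠ 0 := by omega
      exact_mod_cast this
    have hx' : x = (j : ℂ)⁻¹ • ⁅(gradingElt B : 𝔤), x⁆ := by
      rw [mem_gradedPiece.mp hx, inv_smul_smul₀ hj0]
    rw [hx']
    refine Submodule.smul_mem _ _ (Submodule.subset_span ⟨_, ?_, _, ?_, rfl⟩)
    · rw [borelSub_eq]
      exact gradingElt_mem
    · rw [borelSub_eq]
      exact gradedPiece_le_gradedFiltration (by omega) hx

/-- A principal nilpotent element of degree `-1` acts injectively on the nilradical. -/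
theorem disjoint_ker_ad_gradedFiltration {f : 𝔤} (hf : f ∈ gradedPiece B (-1))
    (hp : IsPrincipalNilpotent H f) :
    Disjoint (LinearMap.ker (LieAlgebra.ad ℂ 𝔤 f)) (gradedFiltration B 1) := by
  -- As `ad f` maps `bm = H ⊕ nm` into `nm`, its kernel on `bm` has dimension at least `dim H`. By
  -- principality this is the whole centralizer, which therefore lives in degrees at most `0`.
  set bm : Submodule ℂ 𝔤 := ⨆ j ∈ Set.Iic (0 : ℤ), gradedPiece B j with hbm
  set nm : Submodule ℂ 𝔤 := ⨆ j ∈ Set.Iio (0 : ℤ), gradedPiece B j with hnm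
  have hbn : bm = gradedPiece B 0 ⊔ nm := by
    refine le_antisymm (iSup₂_le fun j hj => ?_) (sup_le ?_ (iSup₂_le fun j hj => ?_))
    · rcases (Set.mem_Iic.mp hj).eq_or_lt with rfl | h
      · exact le_sup_left
      · exact le_sup_of_le_right (le_iSup₂_of_le j h le_rfl)
    · exact le_iSup₂_of_le 0 (Set.mem_Iic.mpr le_rfl) le_rfl
    · exact le_iSup₂_of_le j (Set.mem_Iic.mpr (Set.mem_Iio.mp hj).le) le_rfl
  have hdim : Module.finrank ℂ bm = Module.finrank ℂ H + Module.finrank ℂ nm := by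
    have h := Submodule.finrank_sup_add_finrank_inf_eq (gradedPiece B 0) nm
    rw [← hbn, ((iSupIndep_gradedPiece B).disjoint_biSup (by simp)).eq_bot, finrank_bot,
      gradedPiece_zero] at h
    exact h
  have hmaps : bm ≤ nm.comap (LieAlgebra.ad ℂ 𝔤 f) := iSup₂_le fun j hj x hx =>
    (le_iSup₂_of_le (f := fun j (_ : j ∈ Set.Iio (0 : ℤ)) => gradedPiece B j) (-1 + j)
      (by simp at hj ⊢; omega) le_rfl) (lie_mem_gradedPiece hf hx)
  set T := (LieAlgebra.ad ℂ 𝔤 f).domRestrict bm with hT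
  have hrange : Module.finrank ℂ (LinearMap.range T) ≤ Module.finrank ℂ nm := by
    refine Submodule.finrank_mono ?_
    rintro _ ⟨x, rfl⟩
    exact hmaps x.2
  have hrank := LinearMap.finrank_range_add_finrank_ker T
  have hker : (LinearMap.ker T).map bm.subtype ≤ LinearMap.ker (LieAlgebra.ad ℂ 𝔤 f) := by
    rintro _ ⟨x, hx, rfl⟩
    exact hx
  have hker' : (LinearMap.ker T).map bm.subtype = LinearMap.ker (LieAlgebra.ad ℂ 𝔤 f) := by
    refine Submodule.eq_of_le_of_finrank_le hker ?_
    rw [hp.2, Submodule.finrank_map_subtype_eq]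
    omega
  rw [← hker']
  refine Disjoint.mono_left (Submodule.map_subtype_le _ _) ?_
  exact (iSupIndep_gradedPiece B).disjoint_biSup_biSup (s := Set.Iic 0) (t := Set.Ici 1)
    (Set.disjoint_left.mpr fun j h0 h1 => by simp at h0 h1; omega)

/-- The decomposition `𝔟 = [f, 𝔫] ⊕ 𝔰` is computed by a slice projection. -/
theorem exists_isSliceProjection {f : 𝔤} (hf : f ∈ gradedPiece B (-1))
    (hp : IsPrincipalNilpotent H f) {𝔰 : Submodule ℂ 𝔤}
    (hs_stable : ∀ x ∈ 𝔰, ⁅(gradingElt B : 𝔤), x⁆ ∈ 𝔰)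
    (hs_disj : Disjoint (lieMap f (nilrad B)) 𝔰)
    (hs_sum : lieMap f (nilrad B) ⊔ 𝔰 = borelSub B) :
    ∃ P, IsSliceProjection (gradedFiltration B) f 𝔰 P := by
  obtain ⟨M, hF⟩ := exists_isLieFiltration_gradedFiltration B
  rw [nilrad_eq] at hs_disj hs_sum
  rw [borelSub_eq] at hs_sum
  have hinj := disjoint_ker_ad_gradedFiltration hf hp
  -- The map `𝔫 → 𝔤 / 𝔰`, `z ↦ ⁅f, z⁆`, is injective. Its left inverse is determined only on `𝔟 /
  -- 𝔰`, hence the degree condition on `P` only for `k ≥ 0`.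
  obtain ⟨L, hL⟩ := LinearMap.exists_leftInverse_of_injective
    (𝔰.mkQ ∘ₗ (LieAlgebra.ad ℂ 𝔤 f).domRestrict (gradedFiltration B 1)) (by
      refine LinearMap.ker_eq_bot'.mpr fun z hz => ?_
      have h1 : ⁅f, (z : 𝔤)⁆ ∈ 𝔰 := by simpa using hz
      have h2 : ⁅f, (z : 𝔤)⁆ = 0 :=
        Submodule.disjoint_def.mp hs_disj _ ⟨z, z.2, rfl⟩ h1
      exact Subtype.ext (Submodule.disjoint_def.mp hinj _ h2 z.2))
  set P : 𝔤 →ₗ[ℂ] 𝔤 := (gradedFiltration B 1).subtype ∘ₗ L ∘ₗ 𝔰.mkQ with hP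
  have hPs : ∀ {x}, x ∈ 𝔰 → P x = 0 := fun {x} hx => by
    simp [hP, (Submodule.Quotient.mk_eq_zero 𝔰).mpr hx]
  have hPf : ∀ {z}, z ∈ gradedFiltration B 1 → P ⁅f, z⁆ = z := fun {z} hz =>
    congrArg Subtype.val (LinearMap.congr_fun hL ⟨z, hz⟩)
  have hdec : ∀ {x}, x ∈ gradedFiltration B 0 → x - ⁅f, P x⁆ ∈ 𝔰 := by
    intro x hx
    rw [← hs_sum] at hx
    obtain ⟨_, ⟨z, hz, rfl⟩, y, hy, rfl⟩ := Submodule.mem_sup.mp hx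
    simpa [hPs hy, hPf hz] using hy
  -- Stability of `𝔰` makes the decomposition of `𝔟` graded; since `ad f` lowers degree by one, `P`
  -- raises it by one.
  have hcomm : ∀ {x}, x ∈ gradedFiltration B 0 →
      P ⁅(gradingElt B : 𝔤), x⁆ = ⁅(gradingElt B : 𝔤), P x⁆ - P x := by
    intro x hx
    have hz : P x ∈ gradedFiltration B 1 := (L (𝔰.mkQ x)).2
    have hz' : ⁅(gradingElt B : 𝔤), P x⁆ - P x ∈ gradedFiltration B 1 :=
      Submodule.sub_mem _ (by simpa using hF.lie_mem gradingElt_mem hz) hz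
    have h1 : ⁅(gradingElt B : 𝔤), x⁆ = ⁅f, ⁅(gradingElt B : 𝔤), P x⁆ - P x⁆ +
        ⁅(gradingElt B : 𝔤), x - ⁅f, P x⁆⁆ := by
      rw [lie_sub (gradingElt B : 𝔤), leibniz_lie (gradingElt B : 𝔤) f, mem_gradedPiece.mp hf,
        lie_sub, smul_lie]
      push_cast
      rw [neg_one_smul]
      abel
    rw [h1, map_add, hPf hz', hPs (hs_stable _ (hdec hx)), add_zero]
  refine ⟨P, fun {k} hk x hx => ?_, hdec, hPs, hPf⟩
  refine map_gradedFiltration_le P (fun j hj x hx => ?_) hx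
  refine gradedPiece_le_gradedFiltration (show k + 1 ≤ j + 1 by omega) ?_
  have h := hcomm (gradedPiece_le_gradedFiltration (by omega) hx)
  rw [mem_gradedPiece.mp hx, map_smul] at h
  rw [mem_gradedPiece, sub_eq_iff_eq_add.mp h.symm]
  push_cast
  rw [add_smul, one_smul]

end PrincipalGrading

/-! ### Slice projections for perturbed elements -/

/-- On `F 1` the composite `P ∘ ad (f + f')` is `1 + N` with `N` nilpotent, so `(1 + N)⁻¹ ∘ P` is
the corrected projection. It keeps the degree bounds because `N` preserves each `F k` with `k ≥ 1`.
-/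
theorem IsSliceProjection.exists_add {G : Type*} [LieRing G] [LieAlgebra ℂ G]
    {F : ℤ → Submodule ℂ G} {M : ℕ} (hF : IsLieFiltration F M) {f f' : G} {s : Submodule ℂ G}
    {P : G →ₗ[ℂ] G} (hP : IsSliceProjection F f s P) (hf : f ∈ F (-1)) (hf' : f' ∈ F (-1))
    (hN : IsNilpotent (P ∘ₗ LieAlgebra.ad ℂ G f' : Module.End ℂ G)) :
    ∃ P', IsSliceProjection F (f + f') s P' := by
  set N : Module.End ℂ G := P ∘ₗ LieAlgebra.ad ℂ G f' with hNdef
  obtain ⟨n, hn⟩ := hN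
  set Q : Module.End ℂ G := ∑ i ∈ Finset.range n, (-N) ^ i with hQ
  have hn' : (-N) ^ n = 0 := by rw [neg_pow, hn, mul_zero]
  have hQl : Q * (1 + N) = 1 := by
    have := geom_sum_mul_neg (-N) n
    rwa [hn', sub_zero, sub_neg_eq_add] at this
  have hQr : (1 + N) * Q = 1 := by
    have := mul_neg_geom_sum (-N) n
    rwa [hn', sub_zero, sub_neg_eq_add] at this
  have hNF : ∀ {k : ℤ}, 1 ≤ k → ∀ x ∈ F k, N x ∈ F k := fun {k} hk x hx => by
    have h := hP.map_mem (k := -1 + k) (by omega) (hF.lie_mem hf' hx)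
    rwa [neg_add_cancel_comm] at h
  have hpow : ∀ {k : ℤ}, 1 ≤ k → ∀ (i : ℕ), ∀ x ∈ F k, ((-N) ^ i) x ∈ F k := by
    intro k hk i
    induction i with
    | zero => exact fun x hx => hx
    | succ i ih =>
      intro x hx
      rw [pow_succ, Module.End.mul_apply]
      exact ih _ ((F k).neg_mem (hNF hk x hx))
  have hQF : ∀ {k : ℤ}, 1 ≤ k → ∀ x ∈ F k, Q x ∈ F k := fun {k} hk x hx => by
    rw [hQ, LinearMap.sum_apply]
    exact (F k).sum_mem fun i _ => hpow hk i x hx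
  have hmap : ∀ {k : ℤ}, 0 ≤ k → ∀ {x}, x ∈ F k → (Q ∘ₗ P) x ∈ F (k + 1) :=
    fun hk x hx => hQF (by omega) _ (hP.map_mem hk hx)
  refine ⟨Q ∘ₗ P, hmap, fun {x} hx => ?_, fun {x} hx => ?_, fun {z} hz => ?_⟩
  · set y := x - ⁅f + f', (Q ∘ₗ P) x⁆ with hy
    have hz : (Q ∘ₗ P) x ∈ F 1 := hmap le_rfl hx
    have hyF : y ∈ F 0 := (F 0).sub_mem hx
      (by simpa using hF.lie_mem ((F (-1)).add_mem hf hf') hz)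
    -- `P y = P x - (1 + N) Q (P x)`; an element of `F 0` killed by `P` lies in `s`.
    have hPy : P y = 0 := by
      have h := LinearMap.congr_fun hQr (P x)
      rw [hy, map_sub, add_lie, map_add, hP.map_lie hz]
      exact sub_eq_zero.mpr h.symm
    have := hP.sub_mem hyF
    rwa [hPy, lie_zero, sub_zero] at this
  · simp [hP.map_slice hx]
  · have h := LinearMap.congr_fun hQl z
    rw [LinearMap.comp_apply, add_lie, map_add, hP.map_lie hz]
    exact h

/-! ### Base change along a commutative algebra -/

section BaseChange

variable {𝔤 : Type*} [LieRing 𝔤] [LieAlgebra ℂ 𝔤] (A : Type*) [CommRing A] [Algebra ℂ A]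

/-- The subspace `A ⊗ S` of `A ⊗ 𝔤`. -/
noncomputable def baseChangeSub (S : Submodule ℂ 𝔤) : Submodule ℂ (A ⊗[ℂ] 𝔤) :=
  (S.baseChange A).restrictScalars ℂ

variable {A}

theorem tmul_mem_baseChangeSub {S : Submodule ℂ 𝔤} (a : A) {x : 𝔤} (hx : x ∈ S) :
    a ⊗ₜ[ℂ] x ∈ baseChangeSub A S :=
  Submodule.tmul_mem_baseChange_of_mem a hx

theorem baseChangeSub_mono {S S' : Submodule ℂ 𝔤} (h : S ≤ S') :
    baseChangeSub A S ≤ baseChangeSub A S' :=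
  fun _ hx => Submodule.baseChange_mono A h hx

theorem baseChange_mem_baseChangeSub {S S' : Submodule ℂ 𝔤} (T : 𝔤 →ₗ[ℂ] 𝔤)
    (h : ∀ x ∈ S, T x ∈ S') {y : A ⊗[ℂ] 𝔤} (hy : y ∈ baseChangeSub A S) :
    T.baseChange A y ∈ baseChangeSub A S' := by
  have hle : S.baseChange A ≤ (S'.baseChange A).comap (T.baseChange A) := by
    rw [Submodule.baseChange_eq_span, Submodule.span_le]
    rintro _ ⟨x, hx, rfl⟩
    exact Submodule.tmul_mem_baseChange_of_mem 1 (h x hx)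
  exact hle hy

theorem baseChange_eq_zero_of_mem {S : Submodule ℂ 𝔤} (T : 𝔤 →ₗ[ℂ] 𝔤)
    (h : ∀ x ∈ S, T x = 0) {y : A ⊗[ℂ] 𝔤} (hy : y ∈ baseChangeSub A S) :
    T.baseChange A y = 0 := by
  have := baseChange_mem_baseChangeSub (S' := ⊥) T h hy
  simpa [baseChangeSub] using this

theorem one_tmul_lie (x : 𝔤) (y : A ⊗[ℂ] 𝔤) :
    ⁅(1 : A) ⊗ₜ[ℂ] x, y⁆ = (LieAlgebra.ad ℂ 𝔤 x).baseChange A y :=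
  LinearMap.congr_fun (LieModule.toEnd_baseChange ℂ A 𝔤 𝔤 x) y

theorem lie_mem_baseChangeSub {S S' S'' : Submodule ℂ 𝔤} (h : ∀ x ∈ S, ∀ y ∈ S', ⁅x, y⁆ ∈ S'')
    {x y : A ⊗[ℂ] 𝔤} (hx : x ∈ baseChangeSub A S) (hy : y ∈ baseChangeSub A S') :
    ⁅x, y⁆ ∈ baseChangeSub A S'' := by
  have hle : S.baseChange A ≤ (S''.baseChange A).comap (LieAlgebra.ad A (A ⊗[ℂ] 𝔤) y) := by
    rw [Submodule.baseChange_eq_span, Submodule.span_le]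
    rintro _ ⟨x, hx, rfl⟩
    have := (S''.baseChange A).neg_mem
      (baseChange_mem_baseChangeSub (LieAlgebra.ad ℂ 𝔤 x) (h x hx) hy)
    rwa [← one_tmul_lie, lie_skew] at this
  have := (S''.baseChange A).neg_mem (hle hx)
  rwa [LieAlgebra.ad_apply, lie_skew] at this

theorem IsLieFiltration.baseChange {F : ℤ → Submodule ℂ 𝔤} {M : ℕ} (hF : IsLieFiltration F M) :
    IsLieFiltration (fun k => baseChangeSub A (F k)) M where
  antitone _ _ h := baseChangeSub_mono (hF.antitone h)
  lie_mem hx hy := lie_mem_baseChangeSub (fun _ hx _ hy => hF.lie_mem hx hy) hx hy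
  eq_top := by simp [baseChangeSub, hF.eq_top]
  eq_bot := by simp [baseChangeSub, hF.eq_bot]

theorem IsSliceProjection.baseChange {F : ℤ → Submodule ℂ 𝔤} {f : 𝔤} {s : Submodule ℂ 𝔤}
    {P : 𝔤 →ₗ[ℂ] 𝔤} (hP : IsSliceProjection F f s P) :
    IsSliceProjection (fun k => baseChangeSub A (F k)) ((1 : A) ⊗ₜ[ℂ] f) (baseChangeSub A s)
      ((P.baseChange A).restrictScalars ℂ) where
  map_mem hk _ hx := baseChange_mem_baseChangeSub P (fun _ hx => hP.map_mem hk hx) hx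
  sub_mem {x} hx := by
    have := baseChange_mem_baseChangeSub (LinearMap.id - LieAlgebra.ad ℂ 𝔤 f ∘ₗ P)
      (fun _ hx => hP.sub_mem hx) hx
    rw [LinearMap.baseChange_sub, LinearMap.baseChange_comp, LinearMap.baseChange_id] at this
    rw [one_tmul_lie]
    exact this
  map_slice {x} hx := baseChange_eq_zero_of_mem P (fun _ hx => hP.map_slice hx) hx
  map_lie {z} hz := by
    have := baseChange_eq_zero_of_mem (P ∘ₗ LieAlgebra.ad ℂ 𝔤 f - LinearMap.id)
      (fun z hz => sub_eq_zero.mpr (hP.map_lie hz)) hz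
    rw [LinearMap.baseChange_sub, LinearMap.baseChange_comp, LinearMap.baseChange_id] at this
    rw [one_tmul_lie]
    exact sub_eq_zero.mp this

/-- By `A`-linearity every application of the composite contributes a factor `t`. -/
theorem isNilpotent_comp_ad_smul (P : A ⊗[ℂ] 𝔤 →ₗ[A] A ⊗[ℂ] 𝔤) {t : A} (ht : IsNilpotent t)
    (x : A ⊗[ℂ] 𝔤) : IsNilpotent (P.restrictScalars ℂ ∘ₗ
      LieAlgebra.ad ℂ (A ⊗[ℂ] 𝔤) (t • x) : Module.End ℂ (A ⊗[ℂ] 𝔤)) := by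
  set N : Module.End ℂ (A ⊗[ℂ] 𝔤) := P.restrictScalars ℂ ∘ₗ LieAlgebra.ad ℂ (A ⊗[ℂ] 𝔤) (t • x)
  have hN (y : A ⊗[ℂ] 𝔤) : N y = t • P ⁅x, y⁆ := by
    rw [← map_smul, ← smul_lie]
    rfl
  have h : ∀ (i : ℕ) (y : A ⊗[ℂ] 𝔤), ∃ z, (N ^ i) y = t ^ i • z := by
    intro i
    induction i with
    | zero => exact fun y => ⟨y, by simp⟩
    | succ i ih =>
      intro y
      obtain ⟨z, hz⟩ := ih y
      refine ⟨P ⁅x, z⁆, ?_⟩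
      rw [pow_succ', Module.End.mul_apply, hz, hN, lie_smul, map_smul, smul_smul, pow_succ']
  obtain ⟨n, hn⟩ := ht
  refine ⟨n, LinearMap.ext fun y => ?_⟩
  obtain ⟨z, hz⟩ := h n y
  rw [hz, hn, zero_smul, LinearMap.zero_apply]

theorem isZariskiClosed_translate {V : Type*} [AddCommGroup V] [Module ℂ V] (y : V)
    (S : Submodule ℂ V) : IsZariskiClosed {v | ∃ x ∈ S, v = y + x} := by
  have h : {v | ∃ x ∈ S, v = y + x} = {v | v - y ∈ S} := by
    ext v
    exact ⟨fun ⟨x, hx, hv⟩ => by simpa [hv] using hx, fun hv => ⟨v - y, hv, by abel⟩⟩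
  rw [h]
  exact ((IsPolyMap.linear LinearMap.id).sub (IsPolyMap.const y)).isZariskiClosed_preimage S

/-- The slice theorem for `A ⊗ 𝔤`, at an element congruent to a principal nilpotent one modulo a
nilpotent element of `A`. -/
theorem isVarietyIso_expSubgroup_baseChange [FiniteDimensional ℂ 𝔤] [LieAlgebra.IsKilling ℂ 𝔤]
    [Module.Finite ℂ A] [Module ℚ (A ⊗[ℂ] 𝔤)] {H : LieSubalgebra ℂ 𝔤} [H.IsCartanSubalgebra]
    {B : (LieAlgebra.IsKilling.rootSystem H).Base} {f : 𝔤} (hf : f ∈ gradedPiece B (-1))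
    (hp : IsPrincipalNilpotent H f) {t : A} (ht : IsNilpotent t) {f' : A ⊗[ℂ] 𝔤}
    (hf' : f' ∈ baseChangeSub A (gradedPiece B (-1))) {𝔰 : Submodule ℂ 𝔤}
    (hs_stable : ∀ x ∈ 𝔰, ⁅(gradingElt B : 𝔤), x⁆ ∈ 𝔰)
    (hs_disj : Disjoint (lieMap f (nilrad B)) 𝔰)
    (hs_sum : lieMap f (nilrad B) ⊔ 𝔰 = borelSub B) :
    IsZariskiClosed {a : Module.End ℂ (A ⊗[ℂ] 𝔤) |
      ∃ u ∈ expSubgroup (baseChangeSub A (nilrad B)), (u : Module.End ℂ (A ⊗[ℂ] 𝔤)) = a} ∧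
    IsVarietyIso
      ({a : Module.End ℂ (A ⊗[ℂ] 𝔤) |
        ∃ u ∈ expSubgroup (baseChangeSub A (nilrad B)), (u : Module.End ℂ (A ⊗[ℂ] 𝔤)) = a} ×ˢ
        {y | ∃ x ∈ baseChangeSub A 𝔰, y = ((1 : A) ⊗ₜ[ℂ] f + t • f') + x})
      {y | ∃ x ∈ baseChangeSub A (borelSub B), y = ((1 : A) ⊗ₜ[ℂ] f + t • f') + x}
      (fun p => p.1 p.2) := by
  obtain ⟨M, hF₀⟩ := exists_isLieFiltration_gradedFiltration B
  have hF := hF₀.baseChange (A := A)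
  have hx₀ : (1 : A) ⊗ₜ[ℂ] (gradingElt B : 𝔤) ∈ baseChangeSub A (gradedFiltration B 0) :=
    tmul_mem_baseChangeSub 1 gradingElt_mem
  have hgr : ∀ (j : ℤ), ∀ x ∈ baseChangeSub A (gradedFiltration B j),
      ⁅(1 : A) ⊗ₜ[ℂ] (gradingElt B : 𝔤), x⁆ - (j : ℂ) • x ∈
        baseChangeSub A (gradedFiltration B (j + 1)) := by
    intro j x hx
    have := baseChange_mem_baseChangeSub
      (LieAlgebra.ad ℂ 𝔤 (gradingElt B : 𝔤) - (j : ℂ) • LinearMap.id)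
      (fun x hx => lie_gradingElt_sub_mem j hx) hx
    rw [LinearMap.baseChange_sub, LinearMap.baseChange_smul, LinearMap.baseChange_id] at this
    rw [one_tmul_lie]
    exact this
  obtain ⟨P₀, hP₀⟩ := exists_isSliceProjection hf hp hs_stable hs_disj hs_sum
  have hle : gradedPiece B (-1) ≤ gradedFiltration B (-1) :=
    gradedPiece_le_gradedFiltration le_rfl
  have h0 : (1 : A) ⊗ₜ[ℂ] f ∈ baseChangeSub A (gradedFiltration B (-1)) :=
    tmul_mem_baseChangeSub 1 (hle hf)
  have h1 : t • f' ∈ baseChangeSub A (gradedFiltration B (-1)) :=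
    Submodule.smul_mem ((gradedFiltration B (-1)).baseChange A) _ (baseChangeSub_mono hle hf')
  obtain ⟨P, hP⟩ := hP₀.baseChange.exists_add hF h0 h1 (isNilpotent_comp_ad_smul _ ht f')
  have hs : 𝔰 ≤ gradedFiltration B 0 := by
    rw [← borelSub_eq, ← hs_sum]
    exact le_sup_right
  rw [nilrad_eq, borelSub_eq, hF.expSubgroup_eq_unipotentAut hx₀ hgr]
  exact ⟨isZariskiClosed_unipotentAut _ _,
    hF.isVarietyIso_action (Submodule.add_mem _ h0 h1) hP hx₀ hgr (baseChangeSub_mono hs)⟩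

end BaseChange

/-! ### Takiff algebras -/

instance (l : ℕ) : Module.Finite ℂ (TruncPoly l) :=
  (Polynomial.monic_X_pow (l + 1)).finite_quotient

theorem TruncPoly.isNilpotent_t (l : ℕ) : IsNilpotent (TruncPoly.t l) := by
  refine ⟨l + 1, ?_⟩
  rw [TruncPoly.t, ← map_pow]
  exact Ideal.Quotient.eq_zero_iff_mem.mpr (Ideal.mem_span_singleton_self _)

theorem mainTheorem5 {𝔤 : Type*} [LieRing 𝔤] [LieAlgebra ℂ 𝔤] [FiniteDimensional ℂ 𝔤]
    [LieAlgebra.IsSimple ℂ 𝔤]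
    (H : LieSubalgebra ℂ 𝔤) [H.IsCartanSubalgebra]
    (B : (LieAlgebra.IsKilling.rootSystem H).Base)
    (l : ℕ) (hl : 1 ≤ l)
    (f : Fin (l + 1) → 𝔤)
    (hf_deg : ∀ j, f j ∈ gradedPiece B (-1))
    (hf_princ : ∀ j, IsPrincipalNilpotent H (f j))
    (𝔰 : Submodule ℂ 𝔤)
    (hs_stable : ∀ x ∈ 𝔰, ⁅(gradingElt B : 𝔤), x⁆ ∈ 𝔰)
    (hs_disj : Disjoint (lieMap (f 0) (nilrad B)) 𝔰)
    (hs_sum : lieMap (f 0) (nilrad B) ⊔ 𝔰 = borelSub B) :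
    IsZariskiClosed (Takiff.expVariety (Takiff.sub l (nilrad B))) ∧
    IsZariskiClosed (Takiff.translate (Takiff.ofCoeffs f) (Takiff.sub l 𝔰)) ∧
    IsZariskiClosed (Takiff.translate (Takiff.ofCoeffs f) (Takiff.sub l (borelSub B))) ∧
    IsVarietyIso
      (Takiff.expVariety (Takiff.sub l (nilrad B)) ×ˢ
        Takiff.translate (Takiff.ofCoeffs f) (Takiff.sub l 𝔰))
      (Takiff.translate (Takiff.ofCoeffs f) (Takiff.sub l (borelSub B)))
      (fun p => p.1 p.2) := by
  have hf' : ∑ j : Fin l, (TruncPoly.t l ^ (j : ℕ)) ⊗ₜ[ℂ] f j.succ ∈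
      baseChangeSub (TruncPoly l) (gradedPiece B (-1)) :=
    Submodule.sum_mem _ fun j _ => tmul_mem_baseChangeSub _ (hf_deg j.succ)
  -- The terms with `j ≥ 1` share a factor `t`, so they form a nilpotent perturbation of `f₀`.
  have hf : Takiff.ofCoeffs f = (1 : TruncPoly l) ⊗ₜ[ℂ] f 0 +
      TruncPoly.t l • ∑ j : Fin l, (TruncPoly.t l ^ (j : ℕ)) ⊗ₜ[ℂ] f j.succ := by
    rw [Takiff.ofCoeffs, Fin.sum_univ_succ, Finset.smul_sum]
    refine congrArg₂ _ ?_ (Finset.sum_congr rfl fun j _ => ?_)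
    · exact congrArg (· ⊗ₜ[ℂ] f 0) (pow_zero (TruncPoly.t l))
    · exact congrArg (· ⊗ₜ[ℂ] f j.succ) (pow_succ' (TruncPoly.t l) j)
  have h := isVarietyIso_expSubgroup_baseChange (hf_deg 0) (hf_princ 0) (TruncPoly.isNilpotent_t l)
    hf' hs_stable hs_disj hs_sum
  rw [← hf] at h
  exact ⟨h.1, isZariskiClosed_translate _ _, isZariskiClosed_translate _ _, h.2⟩
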